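/- **Setting.** An episodic dynamic Stackelberg game has a finite state set $\mathcal S=\mathcal S_1\cup\dots\cup\mathcal S_H$ (disjoint layers, $\mathcal S_1=\{s_1\}$), finite action sets $\mathcal A$ (leader; nonempty available subset $\mathcal A(s)$ in state $s$) and $\mathcal B$ (follower), leader rewards $r(s,a,b)\in[0,1]$, follower utility $u(a,b)$, and a transition law $P(\cdot\mid s,a,b)$ that leads from each layer $\mathcal S_h$ with $h<H$ to the next. In state $s$ the leader commits to $x\in\Delta(\mathcal A(s))$; the follower plays $\varphi(s,x)$, a maximizer of $\mathbb E_{a\sim x}u(a,b)$ that, among the maximizers, maximizes $\mathbb E_{a\sim x}r(s,a,b)$; then $a\sim x$ and the next state are sampled. Let $V(\pi)$ be the expected cumulative reward of an episode under a policy $\pi$ (one $\pi(s)\in\Delta(\mathcal A(s))$ per state), and $V^\star=\sup_\pi V(\pi)$. If the policies $\pi_1,\pi_2,\dots$ are played, the cumulative regret is $CR(T)=\sum_{t=1}^T\bigl(V^\star-V(\pi_t)\bigr)$, a random variable through the $\pi_t$. Assume $u(a,b)=\langle f(a,b),\theta^*\rangle$ with known $f:\mathcal A\times\mathcal B\to\mathbb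 R^p$ and unknown $\theta^*\ne0$, that $\|f(a,b)-f(a,b')\|\le L$ for all $a,b,b'$, and the following nondegeneracy with a constant $\eta>0$: for all $s$ and $x\in\Delta(\mathcal A(s))$ there is $y\in\Delta(\mathcal A(s))$ with $\mathbb E_{a\sim y}[u(a,\varphi(s,x))-u(a,b')]\ge\eta\|\theta^*\|$ for all $b'\neq\varphi(s,x)$. (Such an $\eta$ exists exactly when every action that the follower plays in a state is the unique best response to some mixed strategy available there.) **Learning scheme.** Write $m_\theta(x;b,b')=\mathbb E_{a\sim x}\langle f(a,b)-f(a,b'),\theta\rangle$. The version space $\Theta$ is the set of unit vectors $\theta\in\mathbb R^p$ with $m_\theta(x;b,b')\ge0$ for all $b'\in\mathcal B$ and all recorded plays $x$ with observed responses $b$. With parameter $\varepsilon$, before each episode the leader computes by backward induction over the layers, with estimated value $0$ after layer $H$, in each state $s$ a triple $(x_s,\theta_s,b_s)$ and its value $\widetilde V(s)$ that maximize $$\mathbb E_{a\sim x}\Bigl[r(s,a,b)+\sum_{s'}P(s'\mid s,a,b)\widetilde V(s')\Bigr]$$ over $x\in\Delta(\mathcal A(s))$, $\theta\in\Theta$,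 $b\in\mathcal B$ with $m_\theta(x;b,b')\ge\varepsilon$ for all $b'\ne b$; it plays $\pi(s)=x_s$ in that episode and records all plays and responses. (If the program is infeasible in $s$, then $\widetilde V(s)=0$ and $\pi(s)$ is arbitrary; maximizers are chosen arbitrarily.) **Anytime algorithm.** Fix an integer $T_0\ge1$ and $c>0$. The episodes are split into consecutive segments $i=0,1,2,\dots$ of lengths $T_i=2^iT_0$. In segment $i$ the scheme is run with $\varepsilon_i=c\,T_i^{-1/p}$, either (a) with $\Theta$ reset to the unit sphere when the segment begins, or (b) with $\Theta$ carried over from the preceding segments. Neither version uses $T$ or $\delta$. **Claim.** There is a constant $C$ that depends only on $p,H,T_0,c,L,\eta$ (not on $|\mathcal S|,|\mathcal A|,|\mathcal B|$ or the rest of the game) such that for each of the versions (a) and (b), every $T\ge1$ and every $\delta\in(0,1)$, with probability at least $1-\delta$, $$CR(T)\le C\Bigl(T^{1-1/p}(1+\ln T)+\ln\tfrac1\delta\Bigr).$$ In particular $CR(T)=\widetilde{\mathcal O}(T^{1-1/p})$ with probability at least $1-\delta$. -/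

import Mathlib

noncomputable section

/-- An episodic discrete-time dynamic Stackelberg game with state set `S`, leader actions `A`,
follower actions `B` and `H` steps per episode.  `layer` is the partition of the states into `H`
layers (numbered from `0`), the first of which is `{init}`. -/
structure DSG (S A B : Type*) (H : ℕ) where
  layer : S → ℕ
  layer_lt : ∀ s, layer s < H
  init : S
  layer_eq_zero_iff : ∀ s, layer s = 0 ↔ s = init
  /-- The leader's actions available in a state. -/
  avail : S → Finset A
  avail_nonempty : ∀ s, (avail s).Nonempty
  /-- The leader's reward. -/
  r : S → A → B → ℝ
  r_mem : ∀ s a b, r s a b ∈ Set.Icc (0 : ℝ) 1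
  /-- The follower's utility. -/
  u : A → B → ℝ
  /-- The transition law. -/
  P : S → A → B → PMF S
  P_layer : ∀ s a b s', layer s + 1 < H → P s a b s' ≠ 0 → layer s' = layer s + 1

/-- One step of play as recorded by the leader: the state, the mixed strategy committed to, the
follower's response, and the sampled leader action. -/
structure Play (S A B : Type*) where
  state : S
  strat : A → ℝ
  resp : B
  act : A

namespace DSG

variable {S A B : Type*} {H : ℕ} [Fintype S] [Fintype A]

/-- The mixed strategies `Δ(A(s))` available in state `s`. -/
def mixed (G : DSG S A B H) (s : S) : Set (A → ℝ) :=
  {x | x ∈ stdSimplex ℝ A ∧ ∀ a, a ∉ G.avail s → x a = 0}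

/-- The leader's policies: an available mixed strategy for every state. -/
abbrev Policy (G : DSG S A B H) : Type _ := (s : S) → G.mixed s

/-- The follower's expected utility of `b` against the mixed strategy `x`. -/
def expUtil (G : DSG S A B H) (x : A → ℝ) (b : B) : ℝ := ∑ a, x a * G.u a b

/-- `b` is a best response of the follower to `x`. -/
def IsBestResponse (G : DSG S A B H) (x : A → ℝ) (b : B) : Prop :=
  ∀ b', G.expUtil x b' ≤ G.expUtil x b

/-- `φ s x` is the follower's response to `x` in state `s`: a best response, with ties broken in
favour of the leader's expected immediate reward (strong Stackelberg equilibrium). -/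
def IsStrongResponse (G : DSG S A B H) (φ : S → (A → ℝ) → B) : Prop :=
  ∀ s, ∀ x ∈ G.mixed s, G.IsBestResponse x (φ s x) ∧
    ∀ b', G.IsBestResponse x b' → ∑ a, x a * G.r s a b' ≤ ∑ a, x a * G.r s a (φ s x)

/-- The leader's expected reward of playing `x` in state `s`. -/
def auxReward (G : DSG S A B H) (φ : S → (A → ℝ) → B) (s : S) (x : A → ℝ) : ℝ :=
  ∑ a, x a * G.r s a (φ s x)

/-- The expected cumulative reward of `π` over `k` steps starting in state `s`. -/
def value (G : DSG S A B H) (φ : S → (A → ℝ) → B) (π : G.Policy) : ℕ → S → ℝ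
  | 0, _ => 0
  | k + 1, s => G.auxReward φ s (π s) +
      ∑ a, (π s : A → ℝ) a * ∑ s', (G.P s a (φ s (π s)) s').toReal * G.value φ π k s'

/-- The value of an episode under an optimal policy of a leader who knows the follower. -/
def optValue (G : DSG S A B H) (φ : S → (A → ℝ) → B) : ℝ :=
  ⨆ π : G.Policy, G.value φ π H G.init

/-! ### The optimistic conservative program -/

/-- `xᵀ (M_b - M_{b'}) θ`, where the rows of `M_b` are the features `f a b`. -/
def margin {p : ℕ} (f : A → B → EuclideanSpace ℝ (Fin p)) (x : A → ℝ) (b b' : B)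
    (θ : EuclideanSpace ℝ (Fin p)) : ℝ :=
  ∑ a, x a * inner ℝ (f a b - f a b') θ

/-- The update of the version space `Θ` after the response `b` to `x` has been observed. -/
def update {p : ℕ} (f : A → B → EuclideanSpace ℝ (Fin p)) (x : A → ℝ) (b : B)
    (Θ : Set (EuclideanSpace ℝ (Fin p))) : Set (EuclideanSpace ℝ (Fin p)) :=
  Θ ∩ {θ | ‖θ‖ = 1 ∧ ∀ b', 0 ≤ margin f x b b' θ}

/-- The version space after the plays of the given episodes, starting from the unit sphere. -/
def versionSpace {p : ℕ} (f : A → B → EuclideanSpace ℝ (Fin p))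
    (hist : List (List (Play S A B))) : Set (EuclideanSpace ℝ (Fin p)) :=
  hist.flatten.foldl (fun Θ q => update f q.strat q.resp Θ) {θ | ‖θ‖ = 1}

/-- The triple `(x, θ, b)` is feasible for the `ε`-conservative program in state `s`. -/
def Feasible (G : DSG S A B H) {p : ℕ} (f : A → B → EuclideanSpace ℝ (Fin p)) (ε : ℝ)
    (Θ : Set (EuclideanSpace ℝ (Fin p))) (s : S) (x : A → ℝ)
    (θ : EuclideanSpace ℝ (Fin p)) (b : B) : Prop :=
  x ∈ G.mixed s ∧ θ ∈ Θ ∧ ∀ b', b' ≠ b → ε ≤ margin f x b b' θ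

/-- The objective of the program: expected reward plus the estimated value `V` of the next state,
if `x` is played in `s` and the follower responds with `b`.  Nothing follows the last layer. -/
def objective (G : DSG S A B H) (V : S → ℝ) (s : S) (x : A → ℝ) (b : B) : ℝ :=
  ∑ a, x a * (G.r s a b +
    if G.layer s + 1 < H then ∑ s', (G.P s a b s').toReal * V s' else 0)

/-- `π` is a policy that `GetPolicy` may return for the version space `Θ`: in every state its mixed
strategy is part of a triple that maximizes the optimistic value, computed by backward induction.
In a state where the program is infeasible the estimated value is `0` and the strategy is
arbitrary. -/
def IsOptimisticPolicy (G : DSG S A B H) {p : ℕ} (f : A → B → EuclideanSpace ℝ (Fin p)) (ε : ℝ)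
    (Θ : Set (EuclideanSpace ℝ (Fin p))) (π : G.Policy) : Prop :=
  ∃ V : S → ℝ, ∀ s,
    (∃ θ b, G.Feasible f ε Θ s (π s) θ b ∧
      (∀ x' θ' b', G.Feasible f ε Θ s x' θ' b' →
        G.objective V s x' b' ≤ G.objective V s (π s) b) ∧
      V s = G.objective V s (π s) b) ∨
    ((∀ x' θ' b', ¬ G.Feasible f ε Θ s x' θ' b') ∧ V s = 0)

/-! ### Interaction with the follower -/

/-- An available mixed strategy as a probability distribution on actions. -/
def mixedPMF (G : DSG S A B H) {s : S} (x : G.mixed s) : PMF A :=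
  PMF.ofFintype (fun a => ENNReal.ofReal ((x : A → ℝ) a)) (by
    rw [← ENNReal.ofReal_sum_of_nonneg (fun a _ => x.2.1.1 a), x.2.1.2, ENNReal.ofReal_one])

/-- The law of the plays of `k` steps under the policy `π`, starting in state `s`. -/
def episodeLaw (G : DSG S A B H) (φ : S → (A → ℝ) → B) (π : G.Policy) :
    ℕ → S → PMF (List (Play S A B))
  | 0, _ => PMF.pure []
  | k + 1, s => (G.mixedPMF (π s)).bind fun a => (G.P s a (φ s (π s))).bind fun s' =>
      (G.episodeLaw φ π k s').map fun rest => ⟨s, π s, φ s (π s), a⟩ :: rest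

/-- The law of the history of the first `T` episodes of a learner that, after the history `hist`
of complete episodes, plays the policy `rule hist` in the next one. -/
def runLaw (G : DSG S A B H) (φ : S → (A → ℝ) → B)
    (rule : List (List (Play S A B)) → G.Policy) : ℕ → PMF (List (List (Play S A B)))
  | 0 => PMF.pure []
  | T + 1 => (G.runLaw φ rule T).bind fun hist =>
      (G.episodeLaw φ (rule hist) H G.init).map fun e => hist ++ [e]

/-- The cumulative regret over the first `T` episodes along the history `hist`. -/
def regret (G : DSG S A B H) (φ : S → (A → ℝ) → B)
    (rule : List (List (Play S A B)) → G.Policy) (T : ℕ) (hist : List (List (Play S A B))) : ℝ :=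
  ∑ t ∈ Finset.range T, (G.optValue φ - G.value φ (rule (hist.take t)) H G.init)

/-! ### The anytime algorithm -/

/-- The length `2 ^ i * T₀` of segment `i`. -/
def segLength (T₀ i : ℕ) : ℕ := 2 ^ i * T₀

/-- The number of episodes before segment `i`. -/
def segStart (T₀ i : ℕ) : ℕ := ∑ j ∈ Finset.range i, segLength T₀ j

/-- The parameter `ε = c T_i ^ (-1/p)` of the learning scheme for a horizon of `segLength T₀ i`. -/
def segEps (p : ℕ) (c : ℝ) (T₀ i : ℕ) : ℝ := c * (segLength T₀ i : ℝ) ^ (-(1 / (p : ℝ)))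

/-- The anytime scheme in which the version space is reset when a segment begins. -/
def IsAnytimeRestart (G : DSG S A B H) {p : ℕ} (f : A → B → EuclideanSpace ℝ (Fin p))
    (c : ℝ) (T₀ : ℕ) (rule : List (List (Play S A B)) → G.Policy) : Prop :=
  ∀ (i : ℕ) (hist : List (List (Play S A B))),
    segStart T₀ i ≤ hist.length → hist.length < segStart T₀ (i + 1) →
    G.IsOptimisticPolicy f (segEps p c T₀ i)
      (versionSpace f (hist.drop (segStart T₀ i))) (rule hist)

/-- The anytime scheme in which the version space is carried over between segments. -/
def IsAnytimeCarryover (G : DSG S A B H) {p : ℕ} (f : A → B → EuclideanSpace ℝ (Fin p))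
    (c : ℝ) (T₀ : ℕ) (rule : List (List (Play S A B)) → G.Policy) : Prop :=
  ∀ (i : ℕ) (hist : List (List (Play S A B))),
    segStart T₀ i ≤ hist.length → hist.length < segStart T₀ (i + 1) →
    G.IsOptimisticPolicy f (segEps p c T₀ i) (versionSpace f hist) (rule hist)

/-- Every action that the follower plays in a state `s` is, against some mixed strategy available
in `s`, better than all other actions by at least `κ`. -/
def HasResponseMargin (G : DSG S A B H) (φ : S → (A → ℝ) → B) (κ : ℝ) : Prop :=
  ∀ s, ∀ x ∈ G.mixed s, ∃ y ∈ G.mixed s, ∀ b', b' ≠ φ s x →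
    G.expUtil y b' + κ ≤ G.expUtil y (φ s x)

end DSG

end

/-! The regret of one episode is split into a price of conservatism and a price of wrong
predictions. The true direction `‖θ‖⁻¹ • θ` stays in the version space, since the recorded responses
are best responses. If a strategy is mixed, with weight `ε / η`, with one against which the same
response wins by `η * ‖θ‖`, it becomes feasible, at a cost of at most `H * (ε / η)` per step. So the
optimistic estimate falls short of the optimum by at most `H * (H * (ε / η))` (`value_le_estimate`).
Conversely, the estimate exceeds the true value only through wrongly predicted responses, and then
the parameter that certified the prediction has margin at most `-ε` in the observed play. The regret
is thus at most `H * (H * (ε / η)) + H * P`, where `P` is the conditional probability that the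
episode refutes a parameter in this sense (`optValue_sub_value_le`).

Within a segment, the refuted parameters are unit vectors at mutual distance at least `ε / L`: at
the earlier of two plays the later parameter has nonnegative margin, the earlier one at most `-ε`,
and margins are `L`-Lipschitz. The sphere has room for only `O((L / ε) ^ (p - 1))` of them
(`card_refuting_le`). For `ε` of order `T_i ^ (-1/p)`, this number and `T_i * ε` are both of order
`T_i ^ (1 - 1/p)`. The number of segments is logarithmic in `T`.

Since `exp (P / 2 - 1_E)` has conditional expectation at most `1`, Markov's inequality bounds the
sum of the `P` by twice the number of refuting episodes plus `2 * log (1 / δ)`. This is used once,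
for the whole run, so `δ` is not divided among segments. Both versions of the algorithm are covered
by `regret_bound`, whose version space need only lie between those of the full history and of the
current segment. -/

section Auxiliary

open scoped ENNReal

/-! ### Values, optimistic estimates and the cost of conservatism. -/

namespace DSG

variable {S A B : Type*} {H : ℕ}

lemma sum_toReal_P [Fintype S] (G : DSG S A B H) (s : S) (a : A) (b : B) :
    ∑ s', (G.P s a b s').toReal = 1 := by
  rw [← ENNReal.toReal_sum (fun s' _ => (G.P s a b).apply_ne_top s'), ← tsum_fintype (L := .unconditional S),
    PMF.tsum_coe, ENNReal.toReal_one]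

/-- States outside the next layer have probability zero, so the comparison is needed only there.
This drives the backward inductions on the number `k` of remaining steps. -/
lemma sum_P_mul_le [Fintype S] (G : DSG S A B H) {s : S} (hs : G.layer s + 1 < H) (a : A) (b : B)
    {g g' : S → ℝ} (h : ∀ s', G.layer s' = G.layer s + 1 → g s' ≤ g' s') :
    ∑ s', (G.P s a b s').toReal * g s' ≤ ∑ s', (G.P s a b s').toReal * g' s' := by
  refine Finset.sum_le_sum fun s' _ => ?_
  by_cases h0 : G.P s a b s' = 0
  · simp [h0]
  · exact mul_le_mul_of_nonneg_left (h s' (G.P_layer s a b s' hs h0)) ENNReal.toReal_nonneg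

variable [Fintype A]

lemma mixed_sum_le {G : DSG S A B H} {s : S} {x : A → ℝ} (hx : x ∈ G.mixed s) {g : A → ℝ} {d : ℝ}
    (h : ∀ a, g a ≤ d) : ∑ a, x a * g a ≤ d := by
  calc ∑ a, x a * g a ≤ ∑ a, x a * d :=
        Finset.sum_le_sum fun a _ => mul_le_mul_of_nonneg_left (h a) (hx.1.1 a)
    _ = d := by rw [← Finset.sum_mul, hx.1.2, one_mul]

lemma mixed_sum_mono {G : DSG S A B H} {s : S} {x : A → ℝ} (hx : x ∈ G.mixed s) {g g' : A → ℝ}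
    (h : ∀ a, g a ≤ g' a) : ∑ a, x a * g a ≤ ∑ a, x a * g' a :=
  Finset.sum_le_sum fun a _ => mul_le_mul_of_nonneg_left (h a) (hx.1.1 a)

lemma mixed_sum_nonneg {G : DSG S A B H} {s : S} {x : A → ℝ} (hx : x ∈ G.mixed s) {g : A → ℝ}
    (h : ∀ a, 0 ≤ g a) : 0 ≤ ∑ a, x a * g a :=
  Finset.sum_nonneg fun a _ => mul_nonneg (hx.1.1 a) (h a)

lemma mixed_combo {G : DSG S A B H} {s : S} {x y : A → ℝ} (hx : x ∈ G.mixed s) (hy : y ∈ G.mixed s)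
    {l : ℝ} (h0 : 0 ≤ l) (h1 : l ≤ 1) : (1 - l) • x + l • y ∈ G.mixed s := by
  refine ⟨convex_stdSimplex ℝ A hx.1 hy.1 (by linarith) h0 (by ring), fun a ha => ?_⟩
  simp [hx.2 a ha, hy.2 a ha]

lemma value_succ [Fintype S] (G : DSG S A B H) (φ : S → (A → ℝ) → B) (π : G.Policy) (k : ℕ) (s : S) :
    G.value φ π (k + 1) s = ∑ a, (π s : A → ℝ) a * (G.r s a (φ s (π s)) +
      ∑ s', (G.P s a (φ s (π s)) s').toReal * G.value φ π k s') := by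
  simp only [value, auxReward, mul_add, Finset.sum_add_distrib]

lemma value_mem_Icc [Fintype S] (G : DSG S A B H) (φ : S → (A → ℝ) → B) (π : G.Policy) (k : ℕ) (s : S) :
    0 ≤ G.value φ π k s ∧ G.value φ π k s ≤ k := by
  induction k generalizing s with
  | zero => simp [value]
  | succ k ih =>
    rw [value_succ]
    constructor
    · refine mixed_sum_nonneg (π s).2 fun a => add_nonneg (G.r_mem _ _ _).1 ?_
      exact Finset.sum_nonneg fun s' _ => mul_nonneg ENNReal.toReal_nonneg (ih s').1
    · refine mixed_sum_le (π s).2 fun a => ?_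
      have h1 := (G.r_mem s a (φ s (π s))).2
      have h2 : ∑ s', (G.P s a (φ s (π s)) s').toReal * G.value φ π k s' ≤
          ∑ s', (G.P s a (φ s (π s)) s').toReal * (k : ℝ) :=
        Finset.sum_le_sum fun s' _ => mul_le_mul_of_nonneg_left (ih s').2 ENNReal.toReal_nonneg
      rw [← Finset.sum_mul, sum_toReal_P, one_mul] at h2
      push_cast
      linarith

/-- The estimated values lie between `0` and the number of remaining steps. -/
lemma estimate_mem_Icc [Fintype S] (G : DSG S A B H) {p : ℕ} {f : A → B → EuclideanSpace ℝ (Fin p)} {ε : ℝ}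
    {Θ : Set (EuclideanSpace ℝ (Fin p))} {π : G.Policy} {V : S → ℝ}
    (hV : ∀ s, (∃ θ b, G.Feasible f ε Θ s (π s) θ b ∧
      (∀ x' θ' b', G.Feasible f ε Θ s x' θ' b' →
        G.objective V s x' b' ≤ G.objective V s (π s) b) ∧
      V s = G.objective V s (π s) b) ∨
    ((∀ x' θ' b', ¬ G.Feasible f ε Θ s x' θ' b') ∧ V s = 0)) (k : ℕ) (s : S)
    (hs : G.layer s + k = H) :
    0 ≤ V s ∧ V s ≤ k := by
  induction k generalizing s with
  -- No state lies in layer `H`; the induction effectively starts at the last layer, where `k = 1`.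
  | zero => exact absurd (G.layer_lt s) (by omega)
  | succ k ih =>
    rcases hV s with ⟨θ, b, -, -, h⟩ | ⟨-, h⟩
    · rw [h, objective]
      split_ifs with hl
      · constructor
        · refine mixed_sum_nonneg (π s).2 fun a => add_nonneg (G.r_mem _ _ _).1 ?_
          have := G.sum_P_mul_le hl a b (g := fun _ => 0) (g' := V)
            (fun s' hs' => (ih s' (by omega)).1)
          simpa using this
        · refine mixed_sum_le (π s).2 fun a => ?_
          have h1 := (G.r_mem s a b).2
          have h2 := G.sum_P_mul_le hl a b (g := V) (g' := fun _ => (k : ℝ))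
            (fun s' hs' => (ih s' (by omega)).2)
          rw [← Finset.sum_mul, sum_toReal_P, one_mul] at h2
          push_cast
          linarith
      · constructor
        · exact mixed_sum_nonneg (π s).2 fun a => add_nonneg (G.r_mem _ _ _).1 le_rfl
        · refine mixed_sum_le (π s).2 fun a => ?_
          have h1 := (G.r_mem s a b).2
          push_cast
          have : (0 : ℝ) ≤ k := k.cast_nonneg
          linarith
    · rw [h]
      exact ⟨le_rfl, by positivity⟩

/-- The factor `t` is there for `t = ‖θ‖⁻¹`, because version spaces consist of unit vectors. -/
lemma margin_eq_expUtil (G : DSG S A B H) {p : ℕ} {f : A → B → EuclideanSpace ℝ (Fin p)}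
    {θ : EuclideanSpace ℝ (Fin p)} (hu : ∀ a b, G.u a b = inner ℝ (f a b) θ)
    (x : A → ℝ) (b b' : B) (t : ℝ) :
    margin f x b b' (t • θ) = t * (G.expUtil x b - G.expUtil x b') := by
  simp only [margin, expUtil, hu, inner_sub_left, real_inner_smul_right,
    ← Finset.sum_sub_distrib, Finset.mul_sum]
  exact Finset.sum_congr rfl fun a _ => by ring

lemma expUtil_combo (G : DSG S A B H) (x y : A → ℝ) (l : ℝ) (b : B) :
    G.expUtil ((1 - l) • x + l • y) b = (1 - l) * G.expUtil x b + l * G.expUtil y b := by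
  simp only [expUtil, Finset.mul_sum, ← Finset.sum_add_distrib]
  exact Finset.sum_congr rfl fun a _ => by simp; ring

lemma objective_combo [Fintype S] (G : DSG S A B H) (V : S → ℝ) (s : S) (x y : A → ℝ) (l : ℝ) (b : B) :
    G.objective V s ((1 - l) • x + l • y) b =
      (1 - l) * G.objective V s x b + l * G.objective V s y b := by
  simp only [objective, Finset.mul_sum, ← Finset.sum_add_distrib]
  refine Finset.sum_congr rfl fun a _ => ?_
  simp only [Pi.add_apply, Pi.smul_apply, smul_eq_mul]
  ring

/-- Mixing a strategy with one against which the same response has a margin makes it feasible. -/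
lemma feasible_combo [Fintype S] (G : DSG S A B H) {p : ℕ} {f : A → B → EuclideanSpace ℝ (Fin p)}
    {θ : EuclideanSpace ℝ (Fin p)} {φ : S → (A → ℝ) → B} {η ε : ℝ}
    {Θ : Set (EuclideanSpace ℝ (Fin p))} (hθ : θ ≠ 0) (hu : ∀ a b, G.u a b = inner ℝ (f a b) θ)
    (hφ : G.IsStrongResponse φ) (hη : 0 < η) (hε : 0 < ε) (hεη : ε ≤ η) (hΘ : ‖θ‖⁻¹ • θ ∈ Θ)
    {s : S} {x y : A → ℝ} (hx : x ∈ G.mixed s) (hy : y ∈ G.mixed s)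
    (hm : ∀ b', b' ≠ φ s x → G.expUtil y b' + η * ‖θ‖ ≤ G.expUtil y (φ s x)) :
    G.Feasible f ε Θ s ((1 - ε / η) • x + (ε / η) • y) (‖θ‖⁻¹ • θ) (φ s x) := by
  have hl0 : 0 ≤ ε / η := by positivity
  have hl1 : ε / η ≤ 1 := (div_le_one hη).2 hεη
  refine ⟨mixed_combo hx hy hl0 hl1, hΘ, fun b' hb' => ?_⟩
  have hn : 0 < ‖θ‖ := norm_pos_iff.2 hθ
  rw [margin_eq_expUtil G hu, expUtil_combo, expUtil_combo, inv_mul_eq_div, le_div_iff₀ hn]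
  -- The part from `x` is nonnegative because `φ s x` is a best response; the part from `y` alone
  -- supplies `ε / η * (η * ‖θ‖) = ε * ‖θ‖`.
  have h1 := (hφ s x hx).1 b'
  have h2 := hm b' hb'
  have h3 : ε / η * (η * ‖θ‖) = ε * ‖θ‖ := by field_simp
  have h4 : 0 ≤ (1 - ε / η) * (G.expUtil x (φ s x) - G.expUtil x b') :=
    mul_nonneg (by linarith) (by linarith)
  have h5 : ε / η * (η * ‖θ‖) ≤ ε / η * (G.expUtil y (φ s x) - G.expUtil y b') :=
    mul_le_mul_of_nonneg_left (by linarith) hl0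
  linarith

/-- Optimism: the estimated values nearly dominate those of any policy. -/
lemma value_le_estimate [Fintype S] (G : DSG S A B H) {p : ℕ} {f : A → B → EuclideanSpace ℝ (Fin p)}
    {θ : EuclideanSpace ℝ (Fin p)} {φ : S → (A → ℝ) → B} {η ε : ℝ}
    {Θ : Set (EuclideanSpace ℝ (Fin p))} (hθ : θ ≠ 0) (hu : ∀ a b, G.u a b = inner ℝ (f a b) θ)
    (hφ : G.IsStrongResponse φ) (hη : 0 < η) (hm : G.HasResponseMargin φ (η * ‖θ‖)) (hε : 0 < ε)
    (hεη : ε ≤ η) (hΘ : ‖θ‖⁻¹ • θ ∈ Θ) {π : G.Policy} {V : S → ℝ}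
    (hV : ∀ s, (∃ θ b, G.Feasible f ε Θ s (π s) θ b ∧
      (∀ x' θ' b', G.Feasible f ε Θ s x' θ' b' →
        G.objective V s x' b' ≤ G.objective V s (π s) b) ∧
      V s = G.objective V s (π s) b) ∨
    ((∀ x' θ' b', ¬ G.Feasible f ε Θ s x' θ' b') ∧ V s = 0))
    (π' : G.Policy) (k : ℕ) (s : S) (hs : G.layer s + k = H) :
    G.value φ π' k s ≤ V s + k * (H * (ε / η)) := by
  have hl0 : 0 ≤ ε / η := by positivity
  have hl1 : ε / η ≤ 1 := (div_le_one hη).2 hεη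
  induction k generalizing s with
  | zero => exact absurd (G.layer_lt s) (by omega)
  | succ k ih =>
    obtain ⟨y, hy, hy'⟩ := hm s (π' s) (π' s).2
    have hf := feasible_combo G hθ hu hφ hη hε hεη hΘ (π' s).2 hy hy'
    set b := φ s (π' s) with hb
    have hk : (0 : ℝ) ≤ k * (H * (ε / η)) := by positivity
    have hVs : G.objective V s ((1 - ε / η) • (π' s : A → ℝ) + (ε / η) • y) b ≤ V s := by
      rcases hV s with ⟨θ', b', -, h2, h3⟩ | ⟨h1, -⟩
      · rw [h3]
        exact h2 _ _ _ hf
      · exact absurd hf (h1 _ _ _)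
    have hbounds : ∀ a, 0 ≤ (if G.layer s + 1 < H then ∑ s', (G.P s a b s').toReal * V s' else 0) ∧
        (if G.layer s + 1 < H then ∑ s', (G.P s a b s').toReal * V s' else 0) ≤ (k : ℝ) ∧
        ∑ s', (G.P s a b s').toReal * G.value φ π' k s' ≤
          (if G.layer s + 1 < H then ∑ s', (G.P s a b s').toReal * V s' else 0) +
            k * (H * (ε / η)) := by
      intro a
      split_ifs with hl
      · have h1 := G.sum_P_mul_le hl a b (g := fun _ => 0) (g' := V)
          (fun s' hs' => (estimate_mem_Icc G hV k s' (by omega)).1)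
        have h2 := G.sum_P_mul_le hl a b (g := V) (g' := fun _ => (k : ℝ))
          (fun s' hs' => (estimate_mem_Icc G hV k s' (by omega)).2)
        have h3 := G.sum_P_mul_le hl a b (g := G.value φ π' k)
          (g' := fun s' => V s' + k * (H * (ε / η))) (fun s' hs' => ih s' (by omega))
        simp only [mul_add, Finset.sum_add_distrib, ← Finset.sum_mul, sum_toReal_P, one_mul,
          mul_zero, Finset.sum_const_zero] at h1 h2 h3
        exact ⟨h1, h2, h3⟩
      -- In the last layer the program ignores successors, and the value has no steps left.
      · have : k = 0 := by omega
        subst this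
        simp [value]
    have h1 : G.objective V s (π' s) b ≤ H := by
      refine mixed_sum_le (π' s).2 fun a => ?_
      have hr := (G.r_mem s a b).2
      have hkH : ((k + 1 : ℕ) : ℝ) ≤ H := by exact_mod_cast (by omega : k + 1 ≤ H)
      push_cast at hkH
      linarith [(hbounds a).2.1]
    have h2 : 0 ≤ G.objective V s y b :=
      mixed_sum_nonneg hy fun a => add_nonneg (G.r_mem _ _ _).1 (hbounds a).1
    have h3 : G.value φ π' (k + 1) s ≤ G.objective V s (π' s) b + k * (H * (ε / η)) := by
      rw [value_succ]
      calc _ ≤ ∑ a, (π' s : A → ℝ) a * ((G.r s a b + if G.layer s + 1 < H then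
              ∑ s', (G.P s a b s').toReal * V s' else 0) + k * (H * (ε / η))) :=
            mixed_sum_mono (π' s).2 fun a => by linarith [(hbounds a).2.2]
        _ = _ := by
            simp only [mul_add _ (_ + _) (_ * _), Finset.sum_add_distrib, ← Finset.sum_mul,
              (π' s).2.1.2, one_mul, objective]
    -- Mixing loses at most `ε / η` times the objective at `π' s`, hence at most `H * (ε / η)`,
    -- since the contribution of `y` is nonnegative. The other `k` such terms come from the later
    -- steps.
    rw [objective_combo] at hVs
    have h4 := mul_le_mul_of_nonneg_left h1 hl0
    have h5 := mul_nonneg hl0 h2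
    push_cast
    linarith

end DSG

/-! ### Expectations of discrete laws and the exponential Markov inequality. -/

namespace PMF

variable {α β : Type*}

/-- The expectation of a nonnegative function under a probability mass function. -/
noncomputable def expect (μ : PMF α) (g : α → ℝ≥0∞) : ℝ≥0∞ := ∑' x, μ x * g x

lemma expect_pure (a : α) (g : α → ℝ≥0∞) : (PMF.pure a).expect g = g a := by
  rw [expect, tsum_eq_single a (fun b hb => by simp [PMF.pure_apply, hb])]
  simp

lemma expect_bind (μ : PMF α) (κ : α → PMF β) (g : β → ℝ≥0∞) :
    (μ.bind κ).expect g = μ.expect fun a => (κ a).expect g := by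
  simp only [expect, PMF.bind_apply, ← ENNReal.tsum_mul_right, ← ENNReal.tsum_mul_left]
  rw [ENNReal.tsum_comm]
  simp only [mul_assoc]

lemma expect_map (μ : PMF α) (h : α → β) (g : β → ℝ≥0∞) :
    (μ.map h).expect g = μ.expect fun a => g (h a) := by
  rw [← PMF.bind_pure_comp, expect_bind]
  simp only [Function.comp, expect_pure]

lemma expect_mono_of_support (μ : PMF α) {g g' : α → ℝ≥0∞} (h : ∀ a ∈ μ.support, g a ≤ g' a) :
    μ.expect g ≤ μ.expect g' := by
  refine ENNReal.tsum_le_tsum fun a => ?_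
  by_cases ha : μ a = 0
  · simp [ha]
  · exact mul_le_mul_right (h a ((μ.mem_support_iff a).2 ha)) _

lemma expect_const (μ : PMF α) (c : ℝ≥0∞) : μ.expect (fun _ => c) = c := by
  rw [expect, ENNReal.tsum_mul_right, PMF.tsum_coe, one_mul]

lemma expect_const_mul (μ : PMF α) (c : ℝ≥0∞) (g : α → ℝ≥0∞) :
    μ.expect (fun a => c * g a) = c * μ.expect g := by
  simp only [expect, ← ENNReal.tsum_mul_left]
  exact tsum_congr fun a => by ring

lemma expect_add (μ : PMF α) (g g' : α → ℝ≥0∞) :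
    μ.expect (fun a => g a + g' a) = μ.expect g + μ.expect g' := by
  simp only [expect, mul_add, ENNReal.tsum_add]

lemma expect_indicator (μ : PMF α) (s : Set α) :
    μ.expect (s.indicator 1) = μ.toOuterMeasure s := by
  rw [PMF.toOuterMeasure_apply]
  refine tsum_congr fun a => ?_
  by_cases ha : a ∈ s <;> simp [ha]

lemma toOuterMeasure_add_compl (μ : PMF α) (s : Set α) :
    μ.toOuterMeasure s + μ.toOuterMeasure sᶜ = 1 := by
  rw [← expect_indicator, ← expect_indicator, ← expect_add, ← μ.expect_const 1]
  congr 1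
  ext a
  by_cases ha : a ∈ s <;> simp [ha]

lemma toOuterMeasure_le_one (μ : PMF α) (s : Set α) : μ.toOuterMeasure s ≤ 1 :=
  le_self_add.trans_eq (μ.toOuterMeasure_add_compl s)

/-- The one-step bound behind the exponential supermartingale. -/
lemma expect_exp_le_one (μ : PMF α) (s : Set α) :
    μ.expect (fun a => ENNReal.ofReal
      (Real.exp ((μ.toOuterMeasure s).toReal / 2 - s.indicator 1 a))) ≤ 1 := by
  set P := (μ.toOuterMeasure s).toReal with hP
  have htop : μ.toOuterMeasure s ≠ ∞ := ne_top_of_le_ne_top ENNReal.one_ne_top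
    (μ.toOuterMeasure_le_one s)
  have htop' : μ.toOuterMeasure sᶜ ≠ ∞ := ne_top_of_le_ne_top ENNReal.one_ne_top
    (μ.toOuterMeasure_le_one sᶜ)
  have hPc : (μ.toOuterMeasure sᶜ).toReal = 1 - P := by
    have := congrArg ENNReal.toReal (μ.toOuterMeasure_add_compl s)
    rw [ENNReal.toReal_add htop htop', ENNReal.toReal_one] at this
    linarith
  have hP0 : 0 ≤ P := ENNReal.toReal_nonneg
  have hP1 : 0 ≤ 1 - P := hPc ▸ ENNReal.toReal_nonneg
  have hsplit : ∀ a, ENNReal.ofReal (Real.exp (P / 2 - s.indicator 1 a)) =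
      ENNReal.ofReal (Real.exp (P / 2 - 1)) * s.indicator 1 a +
        ENNReal.ofReal (Real.exp (P / 2)) * sᶜ.indicator 1 a := by
    intro a
    by_cases ha : a ∈ s <;> simp [ha]
  simp only [hsplit]
  rw [expect_add, expect_const_mul, expect_const_mul, expect_indicator, expect_indicator,
    ← ENNReal.ofReal_toReal htop, ← ENNReal.ofReal_toReal htop', hPc, ← hP,
    ← ENNReal.ofReal_mul (Real.exp_pos _).le, ← ENNReal.ofReal_mul (Real.exp_pos _).le,
    ← ENNReal.ofReal_add (by positivity) (mul_nonneg (Real.exp_pos _).le hP1),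
    ← ENNReal.ofReal_one]
  refine ENNReal.ofReal_le_ofReal ?_
  -- The expectation is `exp (P / 2) * (exp (-1) * P + (1 - P))`. As `exp (-1) ≤ 1 / 2`, the bracket
  -- is at most `1 - P / 2 ≤ exp (-(P / 2))`.
  have h1 : Real.exp (-1) ≤ 1 / 2 := by
    have := Real.exp_neg_one_lt_d9
    linarith
  have h2 : Real.exp (P / 2 - 1) = Real.exp (P / 2) * Real.exp (-1) := by
    rw [← Real.exp_add]; ring_nf
  have h3 : 1 - P / 2 ≤ Real.exp (-(P / 2)) := by
    have := Real.add_one_le_exp (-(P / 2))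
    linarith
  have h4 : Real.exp (-(P / 2)) * Real.exp (P / 2) = 1 := by
    rw [← Real.exp_add]; simp
  have h5 := Real.exp_pos (P / 2)
  calc Real.exp (P / 2 - 1) * P + Real.exp (P / 2) * (1 - P)
      = Real.exp (P / 2) * (Real.exp (-1) * P + (1 - P)) := by rw [h2]; ring
    _ ≤ Real.exp (P / 2) * (1 / 2 * P + (1 - P)) := by gcongr
    _ ≤ Real.exp (P / 2) * Real.exp (-(P / 2)) := by gcongr; linarith
    _ = 1 := by rw [mul_comm, h4]

/-- Markov's inequality for the exponential of a random variable. -/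
lemma le_toOuterMeasure_of_expect_exp (μ : PMF α) {Z : α → ℝ}
    (hZ : μ.expect (fun a => ENNReal.ofReal (Real.exp (Z a))) ≤ 1) {δ : ℝ} (hδ : 0 < δ)
    {s : Set α} (hs : ∀ a ∈ μ.support, Z a ≤ Real.log (1 / δ) → a ∈ s) :
    ENNReal.ofReal (1 - δ) ≤ μ.toOuterMeasure s := by
  rw [ENNReal.ofReal_sub _ hδ.le, ENNReal.ofReal_one, tsub_le_iff_right,
    ← μ.toOuterMeasure_add_compl s]
  gcongr
  calc μ.toOuterMeasure sᶜ = μ.expect (sᶜ.indicator 1) := (expect_indicator _ _).symm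
    _ ≤ μ.expect (fun a => ENNReal.ofReal δ * ENNReal.ofReal (Real.exp (Z a))) := by
        refine μ.expect_mono_of_support fun a ha => ?_
        by_cases has : a ∈ s
        · simp [has]
        · have h1 : Real.log (1 / δ) < Z a := not_le.1 fun h => has (hs a ha h)
          have h2 : 1 / δ ≤ Real.exp (Z a) := by
            rw [← Real.exp_log (by positivity : 0 < 1 / δ)]
            exact Real.exp_le_exp.2 h1.le
          rw [Set.indicator_of_mem (by exact has), ← ENNReal.ofReal_mul hδ.le, Pi.one_apply,
            ENNReal.one_le_ofReal]
          rwa [div_le_iff₀' hδ] at h2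
    _ ≤ ENNReal.ofReal δ := by
        rw [expect_const_mul]
        exact (mul_le_mul_right hZ _).trans_eq (mul_one _)

end PMF

/-! ### Refuting episodes and the regret of one episode. -/

namespace DSG

variable {S A B : Type*} {H : ℕ} [Fintype A]

/-- The play `q` refutes, with margin `ε`, a parameter in `Θ`. -/
def Refutes {p : ℕ} (f : A → B → EuclideanSpace ℝ (Fin p)) (ε : ℝ)
    (Θ : Set (EuclideanSpace ℝ (Fin p))) (q : Play S A B) : Prop :=
  q.strat ∈ stdSimplex ℝ A ∧ ∃ θ ∈ Θ, ∃ b', margin f q.strat q.resp b' θ ≤ -ε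

/-- The episodes in which some play refutes a parameter in `Θ`. -/
def refuting {p : ℕ} (f : A → B → EuclideanSpace ℝ (Fin p)) (ε : ℝ)
    (Θ : Set (EuclideanSpace ℝ (Fin p))) : Set (List (Play S A B)) :=
  {e | ∃ q ∈ e, Refutes f ε Θ q}

lemma toReal_mixedPMF (G : DSG S A B H) {s : S} (x : G.mixed s) (a : A) :
    (G.mixedPMF x a).toReal = (x : A → ℝ) a := by
  rw [mixedPMF, PMF.ofFintype_apply, ENNReal.toReal_ofReal (x.2.1.1 a)]

variable [Fintype S]

/-- This has the shape of the recursion for `value`, so values and probabilities of refutation can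
be compared term by term. -/
lemma toOuterMeasure_episodeLaw_succ (G : DSG S A B H) (φ : S → (A → ℝ) → B) (π : G.Policy)
    (k : ℕ) (s : S) (E : Set (List (Play S A B))) :
    ((G.episodeLaw φ π (k + 1) s).toOuterMeasure E).toReal =
      ∑ a, (π s : A → ℝ) a * ∑ s', (G.P s a (φ s (π s)) s').toReal *
        ((G.episodeLaw φ π k s').toOuterMeasure
          {e | (⟨s, π s, φ s (π s), a⟩ : Play S A B) :: e ∈ E}).toReal := by
  have hne : ∀ (s' : S) (E : Set (List (Play S A B))),
      (G.episodeLaw φ π k s').toOuterMeasure E ≠ ∞ := fun s' E =>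
    ne_top_of_le_ne_top ENNReal.one_ne_top (PMF.toOuterMeasure_le_one _ _)
  rw [episodeLaw, PMF.toOuterMeasure_bind_apply, tsum_fintype, ENNReal.toReal_sum]
  · refine Finset.sum_congr rfl fun a _ => ?_
    rw [ENNReal.toReal_mul, toReal_mixedPMF, PMF.toOuterMeasure_bind_apply, tsum_fintype,
      ENNReal.toReal_sum]
    · simp only [ENNReal.toReal_mul, PMF.toOuterMeasure_map_apply]
      rfl
    · exact fun s' _ => ENNReal.mul_ne_top (PMF.apply_ne_top _ _)
        (ne_top_of_le_ne_top ENNReal.one_ne_top (PMF.toOuterMeasure_le_one _ _))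
  · exact fun s' _ => ENNReal.mul_ne_top (PMF.apply_ne_top _ _)
      (ne_top_of_le_ne_top ENNReal.one_ne_top (PMF.toOuterMeasure_le_one _ _))

/-- The estimated value exceeds the actual one only through refuting episodes. -/
lemma estimate_le_value (G : DSG S A B H) {p : ℕ} {f : A → B → EuclideanSpace ℝ (Fin p)}
    {φ : S → (A → ℝ) → B} {ε : ℝ} {Θ : Set (EuclideanSpace ℝ (Fin p))} {π : G.Policy} {V : S → ℝ}
    (hV : ∀ s, (∃ θ b, G.Feasible f ε Θ s (π s) θ b ∧
      (∀ x' θ' b', G.Feasible f ε Θ s x' θ' b' →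
        G.objective V s x' b' ≤ G.objective V s (π s) b) ∧
      V s = G.objective V s (π s) b) ∨
    ((∀ x' θ' b', ¬ G.Feasible f ε Θ s x' θ' b') ∧ V s = 0)) (k : ℕ) (s : S)
    (hs : G.layer s + k = H) :
    V s ≤ G.value φ π k s +
      H * ((G.episodeLaw φ π k s).toOuterMeasure (refuting f ε Θ)).toReal := by
  induction k generalizing s with
  | zero => exact absurd (G.layer_lt s) (by omega)
  | succ k ih =>
    rcases hV s with ⟨θ, b, hf, -, h⟩ | ⟨-, h⟩
    · by_cases hb : b = φ s (π s)
      · rw [h, value_succ, toOuterMeasure_episodeLaw_succ, objective, Finset.mul_sum,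
          ← Finset.sum_add_distrib]
        refine Finset.sum_le_sum fun a _ => ?_
        rw [mul_left_comm, ← mul_add]
        refine mul_le_mul_of_nonneg_left ?_ ((π s).2.1.1 a)
        rw [hb, add_assoc]
        gcongr
        rw [Finset.mul_sum, ← Finset.sum_add_distrib]
        split_ifs with hl
        · refine (G.sum_P_mul_le hl a _ (g' := fun s' => G.value φ π k s' + H *
            ((G.episodeLaw φ π k s').toOuterMeasure (refuting f ε Θ)).toReal)
            (fun s' hs' => ih s' (by omega))).trans (Finset.sum_le_sum fun s' _ => ?_)
          rw [mul_left_comm (H : ℝ), ← mul_add]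
          gcongr
          · exact ne_top_of_le_ne_top ENNReal.one_ne_top (PMF.toOuterMeasure_le_one _ _)
          · rintro e ⟨q, hq, hq'⟩
            exact ⟨q, List.mem_cons_of_mem _ hq, hq'⟩
        · exact Finset.sum_nonneg fun s' _ => add_nonneg
            (mul_nonneg ENNReal.toReal_nonneg (value_mem_Icc G φ π k s').1) (by positivity)
      -- After a wrong prediction, the margin of at least `ε` of `b` over the actual response
      -- becomes at most `-ε` when the two are swapped. The first play already refutes `θ`, whatever
      -- follows, so the probability is `1` and `H` covers the whole estimate.
      · have hall : ∀ a, {e | (⟨s, π s, φ s (π s), a⟩ : Play S A B) :: e ∈ refuting f ε Θ} =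
            Set.univ := by
          refine fun a => Set.eq_univ_of_forall fun e => ⟨_, List.mem_cons_self, hf.1.1, θ, hf.2.1,
            b, ?_⟩
          have h1 := hf.2.2 _ (Ne.symm hb)
          have h2 : margin f (π s : A → ℝ) (φ s (π s)) b θ =
              -margin f (π s : A → ℝ) b (φ s (π s)) θ := by
            simp only [margin, ← Finset.sum_neg_distrib, ← mul_neg, ← inner_neg_left, neg_sub]
          simp only [h2]
          linarith
        have huniv : ∀ μ : PMF (List (Play S A B)), (μ.toOuterMeasure Set.univ).toReal = 1 := by
          intro μ
          rw [PMF.toOuterMeasure_apply, Set.indicator_univ, PMF.tsum_coe, ENNReal.toReal_one]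
        have hone : ((G.episodeLaw φ π (k + 1) s).toOuterMeasure (refuting f ε Θ)).toReal = 1 := by
          simp only [toOuterMeasure_episodeLaw_succ, hall, huniv, mul_one, sum_toReal_P,
            (π s).2.1.2]
        rw [hone]
        have h1 := (estimate_mem_Icc G hV (k + 1) s hs).2
        have h2 : ((k + 1 : ℕ) : ℝ) ≤ H := by exact_mod_cast (by omega : k + 1 ≤ H)
        have h3 := (value_mem_Icc G φ π (k + 1) s).1
        linarith
    · rw [h]
      exact add_nonneg (value_mem_Icc G φ π _ s).1 (by positivity)

/-- The expected regret of an episode played by an optimistic policy. -/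
lemma optValue_sub_value_le (G : DSG S A B H) {p : ℕ} {f : A → B → EuclideanSpace ℝ (Fin p)}
    {θ : EuclideanSpace ℝ (Fin p)} {φ : S → (A → ℝ) → B} {η ε : ℝ}
    {Θ : Set (EuclideanSpace ℝ (Fin p))} (hθ : θ ≠ 0) (hu : ∀ a b, G.u a b = inner ℝ (f a b) θ)
    (hφ : G.IsStrongResponse φ) (hη : 0 < η) (hm : G.HasResponseMargin φ (η * ‖θ‖)) (hε : 0 < ε)
    (hΘ : ‖θ‖⁻¹ • θ ∈ Θ) {π : G.Policy} (hπ : G.IsOptimisticPolicy f ε Θ π) :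
    G.optValue φ - G.value φ π H G.init ≤ H * (H * (ε / η)) +
      H * ((G.episodeLaw φ π H G.init).toOuterMeasure (refuting f ε Θ)).toReal := by
  have hinit : G.layer G.init + H = H := by rw [(G.layer_eq_zero_iff _).2 rfl, zero_add]
  have hH : (1 : ℝ) ≤ H := by
    have := G.layer_lt G.init
    exact_mod_cast (by omega : 1 ≤ H)
  have : Nonempty G.Policy := ⟨π⟩
  have hq : 0 ≤ H * ((G.episodeLaw φ π H G.init).toOuterMeasure (refuting f ε Θ)).toReal := by
    positivity
  by_cases hεη : ε ≤ η
  · obtain ⟨V, hV⟩ := hπ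
    have h1 : G.optValue φ ≤ V G.init + H * (H * (ε / η)) := ciSup_le fun π' =>
      value_le_estimate G hθ hu hφ hη hm hε hεη hΘ hV π' H G.init hinit
    have h2 := estimate_le_value G (φ := φ) hV H G.init hinit
    linarith
  -- For `ε > η` the weight `ε / η` is not admissible, but then the first error term alone exceeds
  -- the trivial bound `H`.
  · have h1 : G.optValue φ ≤ H := ciSup_le fun π' => (value_mem_Icc G φ π' H G.init).2
    have h2 := (value_mem_Icc G φ π H G.init).1
    have h3 : 1 ≤ ε / η := (one_le_div hη).2 (not_le.1 hεη).le
    have h4 : (1 : ℝ) ≤ H * (ε / η) := one_le_mul_of_one_le_of_one_le hH h3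
    have h5 : (H : ℝ) ≤ H * (H * (ε / η)) := le_mul_of_one_le_right (by positivity) h4
    linarith

end DSG

/-! ### Packing of the unit sphere. -/

section Packing

open MeasureTheory Metric

/-- The packing number of the unit sphere, by comparing volumes in the surrounding shell. -/
lemma card_mul_pow_le_of_separated_unit {p : ℕ} (hp : p ≠ 0) {ι : Type*} (J : Finset ι)
    (x : ι → EuclideanSpace ℝ (Fin p)) {ρ : ℝ} (h0 : 0 < ρ) (h1 : ρ ≤ 1)
    (hx : ∀ i ∈ J, ‖x i‖ = 1) (hsep : ∀ i ∈ J, ∀ j ∈ J, i ≠ j → ρ ≤ ‖x i - x j‖) :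
    (J.card : ℝ) * ρ ^ (p - 1) ≤ p * 4 ^ p := by
  obtain ⟨r, rfl⟩ : ∃ r, ρ = 2 * r := ⟨ρ / 2, by ring⟩
  have hr0 : 0 < r := by linarith
  have hr1 : r ≤ 1 / 2 := by linarith
  set μ : Measure (EuclideanSpace ℝ (Fin p)) := volume
  have hball : ∀ (y : EuclideanSpace ℝ (Fin p)) (s : ℝ), 0 < s →
      (μ (ball y s)).toReal = s ^ p * (μ (ball 0 1)).toReal := by
    intro y s hs
    rw [Measure.addHaar_ball_of_pos μ y hs, finrank_euclideanSpace_fin, ENNReal.toReal_mul,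
      ENNReal.toReal_ofReal (by positivity)]
  have hfin : ∀ (y : EuclideanSpace ℝ (Fin p)) (s : ℝ), μ (ball y s) ≠ ∞ :=
    fun y s => measure_ball_lt_top.ne
  have hV : 0 < (μ (ball (0 : EuclideanSpace ℝ (Fin p)) 1)).toReal :=
    ENNReal.toReal_pos (measure_ball_pos μ 0 one_pos).ne' (hfin 0 1)
  have hdisj : (J : Set ι).PairwiseDisjoint fun i => ball (x i) r := by
    intro i hi j hj hij
    refine ball_disjoint_ball ?_
    rw [dist_eq_norm]
    linarith [hsep i hi j hj hij]
  have hdisj' : Disjoint (⋃ i ∈ J, ball (x i) r) (ball 0 (1 - r)) := by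
    refine Set.disjoint_iUnion₂_left.2 fun i hi => ball_disjoint_ball ?_
    rw [dist_zero_right, hx i hi]
    linarith
  have hsub : (⋃ i ∈ J, ball (x i) r) ∪ ball 0 (1 - r) ⊆ ball 0 (1 + r) := by
    refine Set.union_subset (Set.iUnion₂_subset fun i hi => ball_subset_ball' ?_)
      (ball_subset_ball (by linarith))
    rw [dist_zero_right, hx i hi]
    linarith
  have hvol := ENNReal.toReal_mono (hfin _ _) (measure_mono (μ := μ) hsub)
  rw [measure_union hdisj' measurableSet_ball,
    measure_biUnion_finset hdisj fun i _ => measurableSet_ball,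
    ENNReal.toReal_add (ENNReal.sum_ne_top.2 fun i _ => hfin _ _) (hfin _ _),
    ENNReal.toReal_sum fun i _ => hfin _ _, Finset.sum_congr rfl fun i _ => hball (x i) r hr0,
    hball 0 (1 - r) (by linarith), hball 0 (1 + r) (by linarith), Finset.sum_const, nsmul_eq_mul, ← mul_assoc,
    ← add_mul] at hvol
  -- The volumes give `card * r ^ p + (1 - r) ^ p ≤ (1 + r) ^ p`. The two powers on either side of
  -- the shell differ by at most `2 * r * p * 2 ^ (p - 1)`, and cancelling one `r` lowers the
  -- exponent from `p` to `p - 1`.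
  have h2 := le_of_mul_le_mul_right hvol hV
  have h3 := abs_pow_sub_pow_le (1 + r) (1 - r) p
  rw [abs_of_pos (by linarith : (0 : ℝ) < 1 + r), abs_of_pos (by linarith : (0 : ℝ) < 1 - r),
    max_eq_left (by linarith), abs_of_pos (by linarith : 0 < 1 + r - (1 - r))] at h3
  have h4 := (le_abs_self _).trans h3
  have h5 : (1 + r) ^ (p - 1) ≤ 2 ^ (p - 1) := pow_le_pow_left₀ (by linarith) (by linarith) _
  obtain ⟨k, rfl⟩ := Nat.exists_eq_succ_of_ne_zero hp
  simp only [Nat.succ_eq_add_one, Nat.add_sub_cancel] at *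
  have h6 : (J.card : ℝ) * r ^ k * r ≤ (2 * ((k + 1 : ℕ) : ℝ) * 2 ^ k) * r := by
    calc (J.card : ℝ) * r ^ k * r = J.card * r ^ (k + 1) := by ring
      _ ≤ (1 + r - (1 - r)) * ((k + 1 : ℕ) : ℝ) * (1 + r) ^ k := by linarith
      _ ≤ (1 + r - (1 - r)) * ((k + 1 : ℕ) : ℝ) * 2 ^ k := by
          exact mul_le_mul_of_nonneg_left h5 (mul_nonneg (by linarith) (Nat.cast_nonneg _))
      _ = _ := by ring
  have h7 := le_of_mul_le_mul_right h6 hr0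
  calc (J.card : ℝ) * (2 * r) ^ k = J.card * r ^ k * 2 ^ k := by rw [mul_pow]; ring
    _ ≤ 2 * ((k + 1 : ℕ) : ℝ) * 2 ^ k * 2 ^ k := by gcongr
    _ = ((k + 1 : ℕ) : ℝ) * (2 * (2 * 2) ^ k) := by rw [mul_pow]; ring
    _ ≤ ((k + 1 : ℕ) : ℝ) * 4 ^ (k + 1) := by
        refine mul_le_mul_of_nonneg_left ?_ (Nat.cast_nonneg _)
        have : (0 : ℝ) < 4 ^ k := by positivity
        norm_num [pow_succ]
        linarith

end Packing

/-! ### Counting refuting episodes; the supermartingale along the run. -/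

namespace DSG

variable {S A B : Type*} {H : ℕ} [Fintype A]

lemma margin_sub {p : ℕ} (f : A → B → EuclideanSpace ℝ (Fin p)) (x : A → ℝ) (b b' : B)
    (θ θ' : EuclideanSpace ℝ (Fin p)) :
    margin f x b b' (θ - θ') = margin f x b b' θ - margin f x b b' θ' := by
  simp only [margin, inner_sub_right, mul_sub, Finset.sum_sub_distrib]

/-- Applied to a difference of parameters, this is the Lipschitz bound that separates refuted
parameters. -/
lemma margin_le {p : ℕ} {f : A → B → EuclideanSpace ℝ (Fin p)} {L : ℝ}
    (hL : ∀ a b b', ‖f a b - f a b'‖ ≤ L) {x : A → ℝ} (hx : x ∈ stdSimplex ℝ A) (b b' : B)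
    (θ : EuclideanSpace ℝ (Fin p)) : margin f x b b' θ ≤ L * ‖θ‖ := by
  calc margin f x b b' θ ≤ ∑ a, x a * (L * ‖θ‖) := by
        refine Finset.sum_le_sum fun a _ => mul_le_mul_of_nonneg_left ?_ (hx.1 a)
        exact (real_inner_le_norm _ _).trans (by gcongr; exact hL a b b')
    _ = L * ‖θ‖ := by rw [← Finset.sum_mul, hx.2, one_mul]

/-- Few episodes refute a parameter that is consistent with all the earlier ones. -/
lemma card_refuting_le {p : ℕ} (hp : p ≠ 0) {f : A → B → EuclideanSpace ℝ (Fin p)} {L ε : ℝ}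
    (hL : ∀ a b b', ‖f a b - f a b'‖ ≤ L) (hε : 0 < ε) (hεL : ε ≤ L) (J : Finset ℕ)
    (e : ℕ → List (Play S A B)) (Θ : ℕ → Set (EuclideanSpace ℝ (Fin p)))
    (href : ∀ t ∈ J, e t ∈ refuting f ε (Θ t)) (hunit : ∀ t ∈ J, ∀ θ ∈ Θ t, ‖θ‖ = 1)
    (hcons : ∀ t ∈ J, ∀ t' ∈ J, t < t' → ∀ θ ∈ Θ t', ∀ q ∈ e t, ∀ b',
      0 ≤ margin f q.strat q.resp b' θ) :
    (J.card : ℝ) * (ε / L) ^ (p - 1) ≤ p * 4 ^ p := by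
  have hL0 : 0 < L := hε.trans_le hεL
  have hex : ∀ t, ∃ θ, t ∈ J → θ ∈ Θ t ∧ ∃ q ∈ e t, q.strat ∈ stdSimplex ℝ A ∧
      ∃ b', margin f q.strat q.resp b' θ ≤ -ε := by
    intro t
    by_cases ht : t ∈ J
    · obtain ⟨q, hq, hx, θ, hθ, b', hb'⟩ := href t ht
      exact ⟨θ, fun _ => ⟨hθ, q, hq, hx, b', hb'⟩⟩
    · exact ⟨0, fun h => absurd h ht⟩
  choose θ hθ using hex
  have hlt : ∀ t ∈ J, ∀ t' ∈ J, t < t' → ε / L ≤ ‖θ t' - θ t‖ := by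
    intro t ht t' ht' htt'
    obtain ⟨-, q, hq, hx, b', hb'⟩ := hθ t ht
    have h1 := hcons t ht t' ht' htt' _ (hθ t' ht').1 q hq b'
    have h2 := margin_le hL hx q.resp b' (θ t' - θ t)
    rw [margin_sub] at h2
    rw [div_le_iff₀' hL0]
    linarith
  refine card_mul_pow_le_of_separated_unit hp J θ (by positivity) ((div_le_one hL0).2 hεL)
    (fun t ht => hunit t ht _ (hθ t ht).1) fun t ht t' ht' hne => ?_
  rcases lt_or_gt_of_ne hne with h | h
  · rw [norm_sub_rev]
    exact hlt t ht t' ht' h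
  · exact hlt t' ht' t ht h

/-- Each update imposes the unit norm again; `hΘ` makes this condition redundant, also when `l` is
empty. -/
lemma mem_foldl_update {p : ℕ} (f : A → B → EuclideanSpace ℝ (Fin p)) (l : List (Play S A B))
    (Θ : Set (EuclideanSpace ℝ (Fin p))) (hΘ : ∀ θ ∈ Θ, ‖θ‖ = 1)
    (θ : EuclideanSpace ℝ (Fin p)) :
    θ ∈ l.foldl (fun Θ q => update f q.strat q.resp Θ) Θ ↔
      θ ∈ Θ ∧ ∀ q ∈ l, ∀ b', 0 ≤ margin f q.strat q.resp b' θ := by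
  induction l generalizing Θ with
  | nil => simp
  | cons q l ih =>
    rw [List.foldl_cons, ih _ fun θ h => hΘ θ h.1]
    simp only [update, Set.mem_inter_iff, Set.mem_ofPred_eq, List.forall_mem_cons]
    have := hΘ θ
    tauto

lemma mem_versionSpace {p : ℕ} (f : A → B → EuclideanSpace ℝ (Fin p))
    (hist : List (List (Play S A B))) (θ : EuclideanSpace ℝ (Fin p)) :
    θ ∈ versionSpace f hist ↔
      ‖θ‖ = 1 ∧ ∀ e ∈ hist, ∀ q ∈ e, ∀ b', 0 ≤ margin f q.strat q.resp b' θ := by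
  rw [versionSpace, mem_foldl_update f _ {θ | ‖θ‖ = 1} fun θ h => h]
  simp only [List.mem_flatten, Set.mem_ofPred_eq, forall_exists_index, and_imp]
  exact and_congr_right fun _ => ⟨fun h e he q hq => h q e he hq, fun h q e he hq => h e he q hq⟩

lemma isBestResponse_of_mem_episodeLaw (G : DSG S A B H) {φ : S → (A → ℝ) → B}
    (hφ : G.IsStrongResponse φ) (π : G.Policy) (k : ℕ) (s : S) (e : List (Play S A B))
    (he : e ∈ (G.episodeLaw φ π k s).support) :
    ∀ q ∈ e, G.IsBestResponse q.strat q.resp := by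
  induction k generalizing s e with
  | zero =>
    rw [episodeLaw, PMF.support_pure, Set.mem_singleton_iff] at he
    simp [he]
  | succ k ih =>
    simp only [episodeLaw, PMF.mem_support_bind_iff, PMF.support_map, Set.mem_image] at he
    obtain ⟨a, -, s', -, e', he', rfl⟩ := he
    exact List.forall_mem_cons.2 ⟨(hφ s _ (π s).2).1, ih s' e' he'⟩

lemma length_of_mem_runLaw (G : DSG S A B H) {φ : S → (A → ℝ) → B}
    (rule : List (List (Play S A B)) → G.Policy) (T : ℕ) (hist : List (List (Play S A B)))
    (h : hist ∈ (G.runLaw φ rule T).support) : hist.length = T := by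
  induction T generalizing hist with
  | zero =>
    rw [runLaw, PMF.support_pure, Set.mem_singleton_iff] at h
    simp [h]
  | succ T ih =>
    simp only [runLaw, PMF.mem_support_bind_iff, PMF.support_map, Set.mem_image] at h
    obtain ⟨hist', h', e, -, rfl⟩ := h
    simp [ih hist' h']

/-- This is what keeps the true direction in every version space along the run. -/
lemma isBestResponse_of_mem_runLaw (G : DSG S A B H) {φ : S → (A → ℝ) → B}
    (hφ : G.IsStrongResponse φ) (rule : List (List (Play S A B)) → G.Policy) (T : ℕ)
    (hist : List (List (Play S A B))) (h : hist ∈ (G.runLaw φ rule T).support) :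
    ∀ e ∈ hist, ∀ q ∈ e, G.IsBestResponse q.strat q.resp := by
  induction T generalizing hist with
  | zero =>
    rw [runLaw, PMF.support_pure, Set.mem_singleton_iff] at h
    simp [h]
  | succ T ih =>
    simp only [runLaw, PMF.mem_support_bind_iff, PMF.support_map, Set.mem_image] at h
    obtain ⟨hist', h', e, he, rfl⟩ := h
    intro e' he'
    rcases List.mem_append.1 he' with h1 | h1
    · exact ih hist' h' e' h1
    · rw [List.mem_singleton.1 h1]
      exact G.isBestResponse_of_mem_episodeLaw hφ _ _ _ e he

/-- Conditional probabilities of events minus half their indicators form an exponential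
supermartingale along the run. -/
lemma expect_runLaw_exp_le_one (G : DSG S A B H) (φ : S → (A → ℝ) → B)
    (rule : List (List (Play S A B)) → G.Policy)
    (E : List (List (Play S A B)) → Set (List (Play S A B))) (T : ℕ) :
    (G.runLaw φ rule T).expect (fun hist => ENNReal.ofReal (Real.exp (∑ t ∈ Finset.range T,
      (((G.episodeLaw φ (rule (hist.take t)) H G.init).toOuterMeasure
        (E (hist.take t))).toReal / 2 -
          (E (hist.take t)).indicator 1 (hist.getD t []))))) ≤ 1 := by
  induction T with
  | zero => simp [runLaw, PMF.expect_pure]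
  | succ T ih =>
    rw [runLaw, PMF.expect_bind]
    refine le_trans (PMF.expect_mono_of_support _ fun hist hh => ?_) ih
    have hlen := G.length_of_mem_runLaw rule T hist hh
    rw [PMF.expect_map]
    have hlast : ∀ e : List (Play S A B), ∑ t ∈ Finset.range (T + 1),
        (((G.episodeLaw φ (rule ((hist ++ [e]).take t)) H G.init).toOuterMeasure
          (E ((hist ++ [e]).take t))).toReal / 2 -
            (E ((hist ++ [e]).take t)).indicator (1 : List (Play S A B) → ℝ)
              ((hist ++ [e]).getD t [])) =
        ∑ t ∈ Finset.range T, (((G.episodeLaw φ (rule (hist.take t)) H G.init).toOuterMeasure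
          (E (hist.take t))).toReal / 2 -
            (E (hist.take t)).indicator 1 (hist.getD t [])) +
        (((G.episodeLaw φ (rule hist) H G.init).toOuterMeasure (E hist)).toReal / 2 -
          (E hist).indicator 1 e) := by
      intro e
      rw [Finset.sum_range_succ]
      congr 1
      · refine Finset.sum_congr rfl fun t ht => ?_
        have ht' : t < hist.length := hlen ▸ Finset.mem_range.1 ht
        rw [List.take_append_of_le_length ht'.le, List.getD_append _ _ _ _ ht']
      · rw [← hlen, List.take_left, List.getD_append_right _ _ _ _ le_rfl]
        simp
    simp only [hlast, Real.exp_add, ENNReal.ofReal_mul (Real.exp_pos _).le]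
    -- Given the first `T` episodes, the old factor is a constant and the new one has expectation at
    -- most `1`.
    rw [PMF.expect_const_mul]
    exact (mul_le_mul_right (PMF.expect_exp_le_one _ _) _).trans_eq (mul_one _)

end DSG

/-! ### Doubling segments and the cumulative regret. -/

namespace DSG

/-- The segment to which episode `t` belongs. -/
def segIndex (T₀ t : ℕ) : ℕ := Nat.log 2 (t / T₀ + 1)

lemma segStart_eq (T₀ i : ℕ) : segStart T₀ i = (2 ^ i - 1) * T₀ := by
  rw [segStart]
  simp only [segLength, ← Finset.sum_mul]
  rw [Nat.geomSum_eq le_rfl]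
  simp

/-- Segment `i` begins at `(2 ^ i - 1) * T₀`, so `t` has reached it exactly when `2 ^ i ≤ t / T₀ +
1`. -/
lemma segIndex_eq_iff {T₀ : ℕ} (hT₀ : 0 < T₀) (t i : ℕ) :
    segIndex T₀ t = i ↔ segStart T₀ i ≤ t ∧ t < segStart T₀ (i + 1) := by
  rw [segIndex, Nat.log_eq_iff (Or.inr ⟨one_lt_two, Nat.succ_ne_zero _⟩), segStart_eq, segStart_eq,
    ← Nat.le_div_iff_mul_le hT₀, ← Nat.div_lt_iff_lt_mul hT₀]
  have h1 : 1 ≤ 2 ^ i := Nat.one_le_two_pow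
  have h2 : 1 ≤ 2 ^ (i + 1) := Nat.one_le_two_pow
  omega

lemma segIndex_mono (T₀ : ℕ) {s t : ℕ} (h : s ≤ t) : segIndex T₀ s ≤ segIndex T₀ t :=
  Nat.log_mono_right (Nat.succ_le_succ (Nat.div_le_div_right h))

lemma card_filter_segIndex_le {T₀ : ℕ} (hT₀ : 0 < T₀) (T i : ℕ) :
    ((Finset.range T).filter fun t => segIndex T₀ t = i).card ≤ segLength T₀ i := by
  calc _ ≤ (Finset.Ico (segStart T₀ i) (segStart T₀ (i + 1))).card := by
        refine Finset.card_le_card fun t ht => ?_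
        rw [Finset.mem_Ico]
        exact (segIndex_eq_iff hT₀ t i).1 (Finset.mem_filter.1 ht).2
    _ = segLength T₀ i := by
        rw [Nat.card_Ico, segStart, segStart, Finset.sum_range_succ]
        omega

lemma one_le_segLength {T₀ : ℕ} (hT₀ : 0 < T₀) (i : ℕ) : (1 : ℝ) ≤ segLength T₀ i := by
  exact_mod_cast Nat.mul_pos (Nat.two_pow_pos i) hT₀

lemma segEps_pos {p T₀ : ℕ} {c : ℝ} (hc : 0 < c) (hT₀ : 0 < T₀) (i : ℕ) : 0 < segEps p c T₀ i :=
  mul_pos hc (Real.rpow_pos_of_pos (one_pos.trans_le (one_le_segLength hT₀ i)) _)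

lemma segEps_le {p T₀ : ℕ} {c : ℝ} (hc : 0 < c) (hT₀ : 0 < T₀) (i : ℕ) : segEps p c T₀ i ≤ c :=
  mul_le_of_le_one_right hc.le (Real.rpow_le_one_of_one_le_of_nonpos (one_le_segLength hT₀ i)
    (neg_nonpos.2 (by positivity)))

lemma segLength_mul_segEps {p T₀ : ℕ} {c : ℝ} (hT₀ : 0 < T₀) (i : ℕ) :
    segLength T₀ i * segEps p c T₀ i = c * (segLength T₀ i : ℝ) ^ (1 - 1 / (p : ℝ)) := by
  have h := one_pos.trans_le (one_le_segLength hT₀ i)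
  rw [segEps, sub_eq_add_neg, Real.rpow_add h, Real.rpow_one]
  ring

/-- This is the balance behind the exponent `-1/p`: the packing bound `ε ^ (-(p - 1))` equals a
constant times `T_i ^ (1 - 1/p)`, the order of `T_i * ε`. -/
lemma segEps_pow_mul {p T₀ : ℕ} (hp : p ≠ 0) {c : ℝ} (hT₀ : 0 < T₀) (i : ℕ) :
    segEps p c T₀ i ^ (p - 1) * (segLength T₀ i : ℝ) ^ (1 - 1 / (p : ℝ)) = c ^ (p - 1) := by
  have h := one_pos.trans_le (one_le_segLength hT₀ i)
  have hp' : (p : ℝ) ≠ 0 := by exact_mod_cast hp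
  rw [segEps, mul_pow, ← Real.rpow_mul_natCast h.le, mul_assoc, ← Real.rpow_add h,
    Nat.cast_sub (Nat.one_le_iff_ne_zero.2 hp)]
  have : -(1 / (p : ℝ)) * ((p : ℝ) - (1 : ℕ)) + (1 - 1 / (p : ℝ)) = 0 := by
    push_cast
    field_simp
    ring
  rw [this, Real.rpow_zero, mul_one]

/-- Quantities that are bounded segment by segment, summed over the first `T` episodes. -/
lemma sum_range_le_of_segments {p T₀ : ℕ} (hp : p ≠ 0) (hT₀ : 0 < T₀) {T : ℕ} (hT : 1 ≤ T)
    (g : ℕ → ℝ) {K : ℝ} (hK : 0 ≤ K)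
    (h : ∀ i, ∑ t ∈ (Finset.range T).filter (fun t => segIndex T₀ t = i), g t ≤
      K * (segLength T₀ i : ℝ) ^ (1 - 1 / (p : ℝ))) :
    ∑ t ∈ Finset.range T, g t ≤
      K * (2 * (1 + T₀)) * ((T : ℝ) ^ (1 - 1 / (p : ℝ)) * (1 + Real.log T)) := by
  have hp1 : (1 : ℝ) ≤ p := by exact_mod_cast Nat.one_le_iff_ne_zero.2 hp
  have hα0 : 0 ≤ 1 - 1 / (p : ℝ) := by
    have : 1 / (p : ℝ) ≤ 1 := (div_le_one (by linarith)).2 hp1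
    linarith
  have hα1 : 1 - 1 / (p : ℝ) ≤ 1 := by
    have : 0 ≤ 1 / (p : ℝ) := by positivity
    linarith
  have hT' : (1 : ℝ) ≤ T := by exact_mod_cast hT
  have hT₀' : (0 : ℝ) ≤ T₀ := T₀.cast_nonneg
  have hpow : 2 ^ segIndex T₀ T ≤ T / T₀ + 1 := Nat.pow_log_le_self 2 (Nat.succ_ne_zero _)
  have hseg : ∀ i ∈ Finset.range (segIndex T₀ T + 1),
      (segLength T₀ i : ℝ) ^ (1 - 1 / (p : ℝ)) ≤ (1 + T₀) * (T : ℝ) ^ (1 - 1 / (p : ℝ)) := by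
    intro i hi
    have h1 : segLength T₀ i ≤ (1 + T₀) * T := by
      calc segLength T₀ i ≤ 2 ^ segIndex T₀ T * T₀ := Nat.mul_le_mul_right _
            (Nat.pow_le_pow_right two_pos (Nat.lt_succ_iff.1 (Finset.mem_range.1 hi)))
        _ ≤ (T / T₀ + 1) * T₀ := Nat.mul_le_mul_right _ hpow
        _ = T / T₀ * T₀ + T₀ := by ring
        _ ≤ T + T₀ * T := add_le_add (Nat.div_mul_le_self T T₀) (Nat.le_mul_of_pos_right _ hT)
        _ = (1 + T₀) * T := by ring
    have h2 : (segLength T₀ i : ℝ) ≤ (1 + T₀) * T := by exact_mod_cast h1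
    calc (segLength T₀ i : ℝ) ^ (1 - 1 / (p : ℝ)) ≤ ((1 + T₀) * T : ℝ) ^ (1 - 1 / (p : ℝ)) :=
          Real.rpow_le_rpow (Nat.cast_nonneg _) h2 hα0
      _ = (1 + T₀ : ℝ) ^ (1 - 1 / (p : ℝ)) * (T : ℝ) ^ (1 - 1 / (p : ℝ)) :=
          Real.mul_rpow (by positivity) (by positivity)
      _ ≤ (1 + T₀) * (T : ℝ) ^ (1 - 1 / (p : ℝ)) := by
          gcongr
          exact Real.rpow_le_self_of_one_le (by linarith) hα1
  -- From `2 ^ segIndex T₀ T ≤ T + 1 ≤ 2 * T`, together with `log 2 > 1 / 2`.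
  have hcount : (segIndex T₀ T : ℝ) + 1 ≤ 2 * (1 + Real.log T) := by
    have h1 : (2 : ℝ) ^ segIndex T₀ T ≤ 2 * T := by
      have : 2 ^ segIndex T₀ T ≤ 2 * T := hpow.trans (by
        have := Nat.div_le_self T T₀
        omega)
      exact_mod_cast this
    have h2 := Real.log_le_log (by positivity) h1
    rw [Real.log_pow, Real.log_mul two_ne_zero (by positivity)] at h2
    have h3 := Real.log_two_gt_d9
    have h4 := Real.log_two_lt_d9
    have h5 := Real.log_nonneg hT'
    nlinarith
  have hmaps : ∀ t ∈ Finset.range T, segIndex T₀ t ∈ Finset.range (segIndex T₀ T + 1) :=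
    fun t ht => Finset.mem_range.2 (Nat.lt_succ_of_le
      (segIndex_mono T₀ (Finset.mem_range.1 ht).le))
  rw [← Finset.sum_fiberwise_of_maps_to hmaps]
  -- Every segment is charged the bound for the longest one; the number of segments gives the
  -- logarithm.
  calc _ ≤ ∑ i ∈ Finset.range (segIndex T₀ T + 1),
        K * ((1 + T₀) * (T : ℝ) ^ (1 - 1 / (p : ℝ))) :=
        Finset.sum_le_sum fun i hi => (h i).trans (mul_le_mul_of_nonneg_left (hseg i hi) hK)
    _ = (segIndex T₀ T + 1 : ℝ) * (K * ((1 + T₀) * (T : ℝ) ^ (1 - 1 / (p : ℝ)))) := by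
        rw [Finset.sum_const, Finset.card_range, nsmul_eq_mul]
        push_cast
        ring
    _ ≤ 2 * (1 + Real.log T) * (K * ((1 + T₀) * (T : ℝ) ^ (1 - 1 / (p : ℝ)))) := by gcongr
    _ = _ := by ring

variable {S A B : Type*} {H : ℕ} [Fintype S] [Fintype A]

/-- The regret bound for any scheme whose version space lies between the one that remembers all
plays and the one that remembers the plays of the current segment. -/
lemma regret_bound (G : DSG S A B H) {p T₀ : ℕ} (hT₀ : 0 < T₀) {c L η : ℝ} (hc : 0 < c)
    (hη : 0 < η) {f : A → B → EuclideanSpace ℝ (Fin p)} {θ : EuclideanSpace ℝ (Fin p)}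
    {φ : S → (A → ℝ) → B} (hθ : θ ≠ 0) (hu : ∀ a b, G.u a b = inner ℝ (f a b) θ)
    (hL : ∀ a b b', ‖f a b - f a b'‖ ≤ L) (hcL : c ≤ L) (hφ : G.IsStrongResponse φ)
    (hm : G.HasResponseMargin φ (η * ‖θ‖)) (rule : List (List (Play S A B)) → G.Policy)
    (W : List (List (Play S A B)) → Set (EuclideanSpace ℝ (Fin p)))
    (hrule : ∀ hist, G.IsOptimisticPolicy f (segEps p c T₀ (segIndex T₀ hist.length))
      (W hist) (rule hist))
    (hsub : ∀ hist, versionSpace f hist ⊆ W hist)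
    (hsup : ∀ hist, W hist ⊆
      versionSpace f (hist.drop (segStart T₀ (segIndex T₀ hist.length))))
    (T : ℕ) (δ : ℝ) (hT : 1 ≤ T) (hδ : 0 < δ) (hδ1 : δ < 1) :
    ENNReal.ofReal (1 - δ) ≤ (G.runLaw φ rule T).toOuterMeasure
      {hist | G.regret φ rule T hist ≤
        (H * (H / η * (c * (2 * (1 + T₀)))) +
          H * (2 * (p * 4 ^ p * (L / c) ^ (p - 1) * (2 * (1 + T₀)))) + 2 * H) *
          ((T : ℝ) ^ (1 - 1 / (p : ℝ)) * (1 + Real.log T) + Real.log (1 / δ))} := by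
  have hp : p ≠ 0 := by
    rintro rfl
    exact hθ (Subsingleton.elim _ _)
  have hL0 : 0 < L := hc.trans_le hcL
  -- The event for an episode is determined by the preceding history, as the supermartingale
  -- requires.
  set E : List (List (Play S A B)) → Set (List (Play S A B)) := fun hist =>
    refuting f (segEps p c T₀ (segIndex T₀ hist.length)) (W hist) with hE
  refine PMF.le_toOuterMeasure_of_expect_exp _ (G.expect_runLaw_exp_le_one φ rule E T) hδ
    fun hist hh hZ => ?_
  have hlen := G.length_of_mem_runLaw rule T hist hh
  have hbest := G.isBestResponse_of_mem_runLaw hφ rule T hist hh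
  have htake : ∀ t ∈ Finset.range T, (hist.take t).length = t := fun t ht => by
    rw [List.length_take, hlen, min_eq_left (Finset.mem_range.1 ht).le]
  have hmemW : ∀ t, ‖θ‖⁻¹ • θ ∈ W (hist.take t) := by
    refine fun t => hsub _ ((mem_versionSpace f _ _).2 ⟨?_, fun e he q hq b' => ?_⟩)
    · rw [norm_smul, norm_inv, norm_norm, inv_mul_cancel₀ (norm_ne_zero_iff.2 hθ)]
    · rw [margin_eq_expUtil G hu]
      exact mul_nonneg (by positivity)
        (sub_nonneg.2 (hbest e (List.mem_of_mem_take he) q hq b'))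
  set P : ℕ → ℝ := fun t => ((G.episodeLaw φ (rule (hist.take t)) H G.init).toOuterMeasure
    (E (hist.take t))).toReal with hP
  set X : ℕ → ℝ := fun t => (E (hist.take t)).indicator 1 (hist.getD t []) with hX
  have hregret : G.regret φ rule T hist ≤ ∑ t ∈ Finset.range T,
      (H * (H * (segEps p c T₀ (segIndex T₀ t) / η)) + H * P t) := by
    refine Finset.sum_le_sum fun t ht => ?_
    have h1 := optValue_sub_value_le G hθ hu hφ hη hm (segEps_pos hc hT₀ _) (hmemW t)
      (hrule (hist.take t))
    rw [hP, hE]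
    simp only [htake t ht] at h1 ⊢
    exact h1
  have heps : ∑ t ∈ Finset.range T, segEps p c T₀ (segIndex T₀ t) ≤
      c * (2 * (1 + T₀)) * ((T : ℝ) ^ (1 - 1 / (p : ℝ)) * (1 + Real.log T)) := by
    refine sum_range_le_of_segments hp hT₀ hT _ hc.le fun i => ?_
    rw [← segLength_mul_segEps hT₀, Finset.sum_congr rfl fun t ht => by
      rw [(Finset.mem_filter.1 ht).2], Finset.sum_const, nsmul_eq_mul]
    exact mul_le_mul_of_nonneg_right (by exact_mod_cast card_filter_segIndex_le hT₀ T i)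
      (segEps_pos hc hT₀ i).le
  have hcount : ∑ t ∈ Finset.range T, X t ≤ p * 4 ^ p * (L / c) ^ (p - 1) * (2 * (1 + T₀)) *
      ((T : ℝ) ^ (1 - 1 / (p : ℝ)) * (1 + Real.log T)) := by
    classical
    refine sum_range_le_of_segments hp hT₀ hT _ (by positivity) fun i => ?_
    set J := ((Finset.range T).filter fun t => segIndex T₀ t = i).filter
      fun t => hist.getD t [] ∈ E (hist.take t) with hJ
    have hJT : ∀ t ∈ J, t ∈ Finset.range T ∧ segIndex T₀ t = i ∧
        hist.getD t [] ∈ E (hist.take t) := fun t ht => by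
      simpa only [hJ, Finset.mem_filter, and_assoc] using ht
    have hsum : ∑ t ∈ (Finset.range T).filter (fun t => segIndex T₀ t = i), X t = J.card := by
      rw [hJ, Finset.card_filter]
      push_cast
      exact Finset.sum_congr rfl fun t _ => by simp only [hX, Set.indicator_apply, Pi.one_apply]
    have hεpos := segEps_pos (p := p) hc hT₀ i
    have hW : ∀ t ∈ J, ∀ θ' ∈ W (hist.take t), ‖θ'‖ = 1 ∧
        ∀ e ∈ (hist.take t).drop (segStart T₀ i), ∀ q ∈ e, ∀ b',
          0 ≤ margin f q.strat q.resp b' θ' := by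
      intro t ht θ' hθ'
      obtain ⟨h1, h2, -⟩ := hJT t ht
      have h3 := hsup _ hθ'
      rw [htake t h1, h2] at h3
      exact (mem_versionSpace f _ _).1 h3
    have hcard := card_refuting_le hp hL hεpos ((segEps_le hc hT₀ i).trans hcL) J
      (fun t => hist.getD t []) (fun t => W (hist.take t))
      (fun t ht => by
        obtain ⟨h1, h2, h3⟩ := hJT t ht
        simp only [hE, htake t h1, h2] at h3
        exact h3)
      (fun t ht θ' hθ' => (hW t ht θ' hθ').1)
      (fun t ht t' ht' hlt θ' hθ' q hq b' => by
        refine (hW t' ht' θ' hθ').2 (hist.getD t []) ?_ q hq b'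
        -- Episode `t` belongs to the same segment as `t'` and precedes it, so even a version space
        -- reset at the start of the segment remembers it, at position `t - segStart T₀ i`. The
        -- default `[]` is never reached.
        have h1 : segStart T₀ i ≤ t := ((segIndex_eq_iff hT₀ t i).1 (hJT t ht).2.1).1
        have h2 : t < hist.length := hlen ▸ Finset.mem_range.1 (hJT t ht).1
        rw [List.getD_eq_getElem _ _ h2, List.mem_iff_getElem]
        have h3 := htake t' (hJT t' ht').1
        refine ⟨t - segStart T₀ i, by rw [List.length_drop, h3]; omega, ?_⟩
        rw [List.getElem_drop, List.getElem_take]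
        congr 1
        omega)
    rw [hsum]
    -- The balance identity turns the packing bound into a multiple of `T_i ^ (1 - 1/p)`.
    have h1 := segEps_pow_mul hp (c := c) hT₀ i
    have h2 : 0 < (segEps p c T₀ i / L) ^ (p - 1) := by positivity
    refine le_of_mul_le_mul_right (hcard.trans_eq ?_) h2
    calc (p : ℝ) * 4 ^ p = p * 4 ^ p * ((L / c) ^ (p - 1) * (c ^ (p - 1) / L ^ (p - 1))) := by
          rw [← div_pow, ← mul_pow, div_mul_div_cancel₀ hc.ne', div_self hL0.ne', one_pow, mul_one]
      _ = _ := by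
          rw [← h1, div_pow (segEps p c T₀ i)]
          ring
  have hZ' : ∑ t ∈ Finset.range T, P t ≤
      2 * ∑ t ∈ Finset.range T, X t + 2 * Real.log (1 / δ) := by
    have : ∑ t ∈ Finset.range T, (P t / 2 - X t) ≤ Real.log (1 / δ) := hZ
    rw [Finset.sum_sub_distrib, ← Finset.sum_div] at this
    linarith
  have hD0 : 0 ≤ (T : ℝ) ^ (1 - 1 / (p : ℝ)) * (1 + Real.log T) := by
    have := Real.log_nonneg (show (1 : ℝ) ≤ T by exact_mod_cast hT)
    positivity
  have hlog : 0 ≤ Real.log (1 / δ) := Real.log_nonneg (by rw [le_div_iff₀ hδ]; linarith)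
  set D := (T : ℝ) ^ (1 - 1 / (p : ℝ)) * (1 + Real.log T)
  set K := (p : ℝ) * 4 ^ p * (L / c) ^ (p - 1) * (2 * (1 + T₀))
  have hK : 0 ≤ K := by positivity
  set K' := c * (2 * (1 + (T₀ : ℝ)))
  have hK' : 0 ≤ K' := by positivity
  calc G.regret φ rule T hist ≤ _ := hregret
    _ = H / η * H * ∑ t ∈ Finset.range T, segEps p c T₀ (segIndex T₀ t) +
          H * ∑ t ∈ Finset.range T, P t := by
        rw [Finset.sum_add_distrib, Finset.mul_sum, Finset.mul_sum]
        congr 1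
        exact Finset.sum_congr rfl fun t _ => by ring
    _ ≤ H / η * H * (K' * D) + H * (2 * (K * D) + 2 * Real.log (1 / δ)) := by
        gcongr
        linarith
    _ = (H * (H / η * K') + H * (2 * K)) * D + 2 * H * Real.log (1 / δ) := by ring
    -- A single constant serves both terms: `2 * H`, the coefficient of `log (1 / δ)`, is added to
    -- that of `D`.
    _ ≤ (H * (H / η * K') + H * (2 * K) + 2 * H) * D +
          (H * (H / η * K') + H * (2 * K) + 2 * H) * Real.log (1 / δ) := by
        exact add_le_add
          (mul_le_mul_of_nonneg_right (le_add_of_nonneg_right (by positivity)) hD0)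
          (mul_le_mul_of_nonneg_right (le_add_of_nonneg_left (by positivity)) hlog)
    _ = _ := by ring

end DSG

end Auxiliary

theorem mainTheorem2 (p H T₀ : ℕ) (hT₀ : 0 < T₀) (c L η : ℝ) (hc : 0 < c) (hη : 0 < η) :
    ∃ C : ℝ, ∀ (S : Type*) (A : Type*) (B : Type*) [Fintype S] [Fintype A] [Fintype B]
      (G : DSG S A B H) (f : A → B → EuclideanSpace ℝ (Fin p)) (θ : EuclideanSpace ℝ (Fin p))
      (φ : S → (A → ℝ) → B),
      θ ≠ 0 →
      (∀ a b, G.u a b = inner ℝ (f a b) θ) →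
      (∀ a b b', ‖f a b - f a b'‖ ≤ L) →
      G.IsStrongResponse φ →
      G.HasResponseMargin φ (η * ‖θ‖) →
      (∀ rule : List (List (Play S A B)) → G.Policy, G.IsAnytimeRestart f c T₀ rule →
        ∀ (T : ℕ) (δ : ℝ), 1 ≤ T → 0 < δ → δ < 1 →
          ENNReal.ofReal (1 - δ) ≤ (G.runLaw φ rule T).toOuterMeasure
            {hist | G.regret φ rule T hist ≤
              C * ((T : ℝ) ^ (1 - 1 / (p : ℝ)) * (1 + Real.log T) + Real.log (1 / δ))}) ∧
      (∀ rule : List (List (Play S A B)) → G.Policy, G.IsAnytimeCarryover f c T₀ rule →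
        ∀ (T : ℕ) (δ : ℝ), 1 ≤ T → 0 < δ → δ < 1 →
          ENNReal.ofReal (1 - δ) ≤ (G.runLaw φ rule T).toOuterMeasure
            {hist | G.regret φ rule T hist ≤
              C * ((T : ℝ) ^ (1 - 1 / (p : ℝ)) * (1 + Real.log T) + Real.log (1 / δ))}) := by
  -- The bound `L` is enlarged to `|L| + c`: this is positive and at least every `ε`, as `ε ≤ c`, so
  -- the separation `ε / L` lies in `(0, 1]` as the packing bound needs.
  have hcL : c ≤ |L| + c := le_add_of_nonneg_left (abs_nonneg L)
  refine ⟨H * (H / η * (c * (2 * (1 + T₀)))) +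
    H * (2 * (p * 4 ^ p * ((|L| + c) / c) ^ (p - 1) * (2 * (1 + T₀)))) + 2 * H, ?_⟩
  intro S A B _ _ _ G f θ φ hθ hu hL hφ hm
  have hL' : ∀ a b b', ‖f a b - f a b'‖ ≤ |L| + c := fun a b b' => by
    linarith [hL a b b', le_abs_self L]
  constructor
  · intro rule hrule
    exact G.regret_bound hT₀ hc hη hθ hu hL' hcL hφ hm rule
      (fun hist => DSG.versionSpace f
        (hist.drop (DSG.segStart T₀ (DSG.segIndex T₀ hist.length))))
      (fun hist => by
        obtain ⟨h1, h2⟩ := (DSG.segIndex_eq_iff hT₀ hist.length _).1 rfl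
        exact hrule _ hist h1 h2)
      -- Forgetting the plays of earlier segments only enlarges the version space.
      (fun hist θ' h => (DSG.mem_versionSpace f _ _).2
        ⟨((DSG.mem_versionSpace f _ _).1 h).1, fun e he =>
          ((DSG.mem_versionSpace f _ _).1 h).2 e (List.mem_of_mem_drop he)⟩)
      (fun hist => subset_rfl)
  · intro rule hrule
    exact G.regret_bound hT₀ hc hη hθ hu hL' hcL hφ hm rule (fun hist => DSG.versionSpace f hist)
      (fun hist => by
        obtain ⟨h1, h2⟩ := (DSG.segIndex_eq_iff hT₀ hist.length _).1 rfl
        exact hrule _ hist h1 h2)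
      (fun hist => subset_rfl)
      (fun hist θ' h => (DSG.mem_versionSpace f _ _).2
        ⟨((DSG.mem_versionSpace f _ _).1 h).1, fun e he =>
          ((DSG.mem_versionSpace f _ _).1 h).2 e (List.mem_of_mem_drop he)⟩)
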